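/- Let $X_1, X_2, \dots$ be independent identically distributed random vectors in $\mathbb{R}^2$ such that (H) $\mathbb{P}(X_1 \in h) = 0$ for every affine line $h \subset \mathbb{R}^2$, and (S) $X_1$ and $-X_1$ have the same distribution. Let $S_k = X_1 + \dots + X_k$, $k \ge 1$. Then for every integer $n \ge 1$ $$\mathbb{P}\bigl(0 \notin \operatorname{conv}(S_1, \dots, S_n)\bigr) = \sum_{k=1}^n \frac{(2n-2k-1)!!}{k \cdot (2n-2k)!!},$$ where $\operatorname{conv}$ denotes the convex hull, and $m!!$ is the double factorial, with the conventions $0!! = (-1)!! = 1$. In particular, this probability does not depend on the distribution of $X_1$. -/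

import Mathlib

open MeasureTheory ProbabilityTheory

/-- A random walk with values in `E`, given by its increments `X 0, X 1, …`
(the increments `X₁, X₂, …` of the usual notation): these are independent and identically
distributed random vectors. -/
structure IsRandomWalk {Ω E : Type*} [MeasurableSpace Ω] [MeasurableSpace E]
    (X : ℕ → Ω → E) (P : Measure Ω) : Prop where
  measurable : ∀ i, Measurable (X i)
  indep : iIndepFun X P
  identDistrib : ∀ i, IdentDistrib (X i) (X 0) P P

/-- The position `S_k = X 0 + ⋯ + X (k - 1)` of the walk after `k` steps. -/
def walk {Ω E : Type*} [AddCommMonoid E] (X : ℕ → Ω → E) (k : ℕ) (ω : Ω) : E :=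
  ∑ i ∈ Finset.range k, X i ω

/-- Condition (H): the random vector `Y` in `ℝ^d` lies in any given affine hyperplane with
probability zero. -/
def NoMassOnHyperplanes {Ω : Type*} [MeasurableSpace Ω] {d : ℕ}
    (Y : Ω → EuclideanSpace ℝ (Fin d)) (P : Measure Ω) : Prop :=
  ∀ h : AffineSubspace ℝ (EuclideanSpace ℝ (Fin d)),
    (h : Set (EuclideanSpace ℝ (Fin d))).Nonempty →
    Module.finrank ℝ h.direction + 1 = d → P {ω | Y ω ∈ h} = 0

/-- Condition (S): `Y` and `-Y` have the same distribution. -/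
def CentrallySymmetric {Ω E : Type*} [MeasurableSpace Ω] [MeasurableSpace E] [Neg E]
    (Y : Ω → E) (P : Measure Ω) : Prop :=
  IdentDistrib Y (fun ω => -Y ω) P P

/-!
Write `crossForm v w` for the oriented area spanned by `v, w ∈ ℝ²`. Almost surely no two of the
positions `S_1, …, S_n` are collinear with the origin. Then the origin is outside their convex hull
if and only if they lie in an open half-plane bounded by a line through the origin, that is, if and
only if one of them, say `S_k`, comes first in counterclockwise order: `crossForm S_k S_j > 0` for
all `j ≠ k`. Such a `k` is unique, so the probability is the sum over `k` of the probabilities that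
`S_k` comes first (`IsRandomWalk.measureReal_walk_cross_pos`), and each of these is a product of two
factors.

* The steps up to time `k` form a bridge lying strictly to the left of its chord `S_k`. Rotating the
  first `k` increments cyclically changes neither their joint law nor `S_k`, and exactly one of the
  `k` rotations has the required property, namely the one starting at the lowest point of the bridge.
  Hence the first factor is `1 / k` (`IsRandomWalk.measureReal_leftBridges`).
* Given the first `k` steps, the later heights `crossForm S_k (S_j - S_k)` form a symmetric random
  walk on the line without atoms, which has to stay positive for `m = n - k` steps. Splitting such a
  walk at its minimum shows that the probabilities `p_m` of staying positive satisfy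
  `∑ p_k p_{m-k} = 1`. The numbers `(2m-1)!! / (2m)!!` solve this recursion, which has only one
  solution with `p_0 = 1`, so the second factor is `(2m-1)!! / (2m)!!`
  (`IsRandomWalk.measureReal_positivePaths`).

Conditioning is expressed by `measure_and_eq_mul_of_indepFun`.
-/

/-! ### Partitions and independence -/

theorem measureReal_eq_sum_of_ae_iff {Ω ι : Type*} [MeasurableSpace Ω] {P : Measure Ω}
    [IsFiniteMeasure P] {s : Finset ι} {E : Set Ω} {A : ι → Set Ω}
    (hA : ∀ i ∈ s, MeasurableSet (A i)) (hdisj : (s : Set ι).PairwiseDisjoint A)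
    (hE : ∀ᵐ ω ∂P, ω ∈ E ↔ ∃ i ∈ s, ω ∈ A i) :
    P.real E = ∑ i ∈ s, P.real (A i) := by
  rw [← measureReal_biUnion_finset hdisj hA]
  refine measureReal_congr ?_
  filter_upwards [hE] with ω hω
  refine propext (hω.trans ?_)
  exact (Set.mem_iUnion₂.trans (by simp only [exists_prop])).symm

/-- Fubini for independent random variables: if, given `U ∈ B`, the conditional probability of
`(U, V) ∈ A` is a constant `c`, then the two events multiply. -/
theorem measure_and_eq_mul_of_indepFun {Ω α β : Type*} [MeasurableSpace Ω] [MeasurableSpace α]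
    [MeasurableSpace β] {P : Measure Ω} [IsProbabilityMeasure P] {U : Ω → α} {V : Ω → β}
    (hU : Measurable U) (hV : Measurable V) (h : IndepFun U V P) {B : Set α} {A : Set (α × β)}
    (hB : MeasurableSet B) (hA : MeasurableSet A) {c : ENNReal}
    (hc : ∀ᵐ ω ∂P, U ω ∈ B → P {ω' | (U ω, V ω') ∈ A} = c) :
    P {ω | U ω ∈ B ∧ (U ω, V ω) ∈ A} = P {ω | U ω ∈ B} * c := by
  have hD : MeasurableSet (Prod.fst ⁻¹' B ∩ A) := (measurable_fst hB).inter hA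
  have h1 : P {ω | U ω ∈ B ∧ (U ω, V ω) ∈ A}
      = P.map (fun ω => (U ω, V ω)) (Prod.fst ⁻¹' B ∩ A) := by
    rw [Measure.map_apply (hU.prodMk hV) hD]; rfl
  have := Measure.isProbabilityMeasure_map (μ := P) hV.aemeasurable
  have := Measure.isProbabilityMeasure_map (μ := P) hU.aemeasurable
  rw [h1, (indepFun_iff_map_prod_eq_prod_map_map hU.aemeasurable hV.aemeasurable).1 h,
    Measure.prod_apply hD, lintegral_map (measurable_measure_prodMk_left hD) hU, mul_comm,
    show {ω | U ω ∈ B} = U ⁻¹' B from rfl,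
    ← lintegral_indicator_const (hU hB)]
  refine lintegral_congr_ae ?_
  filter_upwards [hc] with ω hω
  rw [Measure.map_apply hV (measurable_prodMk_left hD)]
  by_cases hωB : U ω ∈ B
  · rw [Set.indicator_of_mem (by exact hωB), ← hω hωB]
    congr 1
    ext ω'
    simp [hωB]
  · rw [Set.indicator_of_notMem (by exact hωB)]
    convert measure_empty (μ := P)
    ext ω'
    simp [hωB]

/-! ### Sequences of independent identically distributed vectors -/

/-- The increments with index in `S`, extended by zero to a sequence: events about a block of
increments can then be written as sets of sequences, like events about all increments. -/
def maskedIncrements {Ω E : Type*} [Zero E] (X : ℕ → Ω → E) (S : Finset ℕ) (ω : Ω) (i : ℕ) : E :=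
  if i ∈ S then X i ω else 0

theorem sum_maskedIncrements {Ω E : Type*} [AddCommMonoid E] {X : ℕ → Ω → E} {S I : Finset ℕ}
    (h : I ⊆ S) (ω : Ω) : ∑ i ∈ I, maskedIncrements X S ω i = ∑ i ∈ I, X i ω :=
  Finset.sum_congr rfl fun _ hi => if_pos (h hi)

section Walk

variable {Ω E F : Type*} [MeasurableSpace Ω] [MeasurableSpace E] [MeasurableSpace F]
  {P : Measure Ω} {X X' : ℕ → Ω → E}

theorem IsRandomWalk.reindex (hX : IsRandomWalk X P) {f : ℕ → ℕ} (hf : f.Injective) :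
    IsRandomWalk (fun i => X (f i)) P where
  measurable _ := hX.measurable _
  indep := hX.indep.precomp hf
  identDistrib _ := (hX.identDistrib _).trans (hX.identDistrib _).symm

theorem IsRandomWalk.comp (hX : IsRandomWalk X P) {g : E → F} (hg : Measurable g) :
    IsRandomWalk (fun i ω => g (X i ω)) P where
  measurable _ := hg.comp (hX.measurable _)
  indep := hX.indep.comp (fun _ => g) (fun _ => hg)
  identDistrib _ := (hX.identDistrib _).comp hg

/-- The law of the whole sequence of increments is determined by the law of one increment. -/
theorem IsRandomWalk.measure_mem_eq (hX : IsRandomWalk X P) (hX' : IsRandomWalk X' P)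
    (h : IdentDistrib (X 0) (X' 0) P P) {B : Set (ℕ → E)} (hB : MeasurableSet B) :
    P {ω | (X · ω) ∈ B} = P {ω | (X' · ω) ∈ B} :=
  (IdentDistrib.pi (fun i => (hX.identDistrib i).trans (h.trans (hX'.identDistrib i).symm))
    hX.indep hX'.indep).measure_mem_eq hB

theorem IsRandomWalk.measurable_maskedIncrements [Zero E] (hX : IsRandomWalk X P)
    (S : Finset ℕ) : Measurable (maskedIncrements X S) := by
  refine measurable_pi_lambda _ fun i => ?_
  by_cases h : i ∈ S
  · simpa [maskedIncrements, h] using hX.measurable i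
  · simp [maskedIncrements, h]

theorem IsRandomWalk.indepFun_maskedIncrements [Zero E] (hX : IsRandomWalk X P)
    {S T : Finset ℕ} (hST : Disjoint S T) :
    IndepFun (maskedIncrements X S) (maskedIncrements X T) P := by
  have key : ∀ S : Finset ℕ,
      Measurable fun (u : S → E) (i : ℕ) => if h : i ∈ S then u ⟨i, h⟩ else 0 := by
    intro S
    refine measurable_pi_lambda _ fun i => ?_
    by_cases h : i ∈ S
    · simpa [h] using measurable_pi_apply _
    · simp [h]
  exact (hX.indep.indepFun_finset S T hST hX.measurable).comp (key S) (key T)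

end Walk

/-! ### Central binomial weights -/

/-- The weight `(2m-1)!! / (2m)!!`, with `(-1)!! = 1`. -/
noncomputable def doubleFactorialRatio (m : ℕ) : ℝ :=
  (Nat.doubleFactorial (2 * m - 1) : ℝ) / (Nat.doubleFactorial (2 * m) : ℝ)

theorem doubleFactorialRatio_zero : doubleFactorialRatio 0 = 1 := by
  simp [doubleFactorialRatio]

theorem doubleFactorialRatio_succ (m : ℕ) :
    (2 * m + 2) * doubleFactorialRatio (m + 1) = (2 * m + 1) * doubleFactorialRatio m := by
  have h1 : Nat.doubleFactorial (2 * (m + 1) - 1) =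
      (2 * m + 1) * Nat.doubleFactorial (2 * m - 1) := Nat.doubleFactorial_add_one (2 * m)
  have h2 : Nat.doubleFactorial (2 * (m + 1)) = (2 * m + 2) * Nat.doubleFactorial (2 * m) :=
    Nat.doubleFactorial_add_two (2 * m)
  have h3 : (Nat.doubleFactorial (2 * m) : ℝ) ≠ 0 := by
    exact_mod_cast (Nat.doubleFactorial_pos _).ne'
  rw [doubleFactorialRatio, doubleFactorialRatio, h1, h2]
  push_cast
  field_simp

open Finset in
/-- The coefficients of `(1 - x)^{-1/2}` convolve to those of `(1 - x)^{-1}`. -/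
theorem sum_antidiagonal_doubleFactorialRatio (m : ℕ) :
    ∑ p ∈ antidiagonal m, doubleFactorialRatio p.1 * doubleFactorialRatio p.2 = 1 := by
  set c := doubleFactorialRatio
  -- By symmetry the weight `p.1` may be replaced by its average `m / 2`.
  have hsymm : ∀ m : ℕ, ∑ p ∈ antidiagonal m, 2 * (p.1 : ℝ) * (c p.1 * c p.2) =
      m * ∑ p ∈ antidiagonal m, c p.1 * c p.2 := by
    intro m
    have h1 : ∑ p ∈ antidiagonal m, (p.1 : ℝ) * (c p.1 * c p.2) =
        ∑ p ∈ antidiagonal m, (p.2 : ℝ) * (c p.1 * c p.2) := by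
      rw [← Nat.sum_antidiagonal_swap]
      exact sum_congr rfl fun p _ => by simp [mul_comm]
    have h2 : ∑ p ∈ antidiagonal m, 2 * (p.1 : ℝ) * (c p.1 * c p.2) =
        ∑ p ∈ antidiagonal m, (p.1 : ℝ) * (c p.1 * c p.2) +
        ∑ p ∈ antidiagonal m, (p.2 : ℝ) * (c p.1 * c p.2) := by
      rw [← h1, ← sum_add_distrib]
      exact sum_congr rfl fun p _ => by ring
    rw [h2, ← sum_add_distrib, mul_sum]
    refine sum_congr rfl fun p hp => ?_
    rw [← mem_antidiagonal.1 hp]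
    push_cast
    ring
  induction m with
  | zero => simp [c, doubleFactorialRatio_zero]
  | succ m ih =>
    have h := hsymm (m + 1)
    have hm := hsymm m
    -- With `(2m + 2) c (m + 1) = (2m + 1) c m`, the sum at `m + 1` is expressed by the sum at `m`.
    rw [Nat.sum_antidiagonal_succ] at h
    have h3 : ∑ p ∈ antidiagonal m, 2 * (((p.1 + 1 : ℕ)) : ℝ) * (c (p.1 + 1) * c p.2) =
        ∑ p ∈ antidiagonal m, 2 * (p.1 : ℝ) * (c p.1 * c p.2) +
        ∑ p ∈ antidiagonal m, c p.1 * c p.2 := by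
      rw [← sum_add_distrib]
      refine sum_congr rfl fun p _ => ?_
      have := doubleFactorialRatio_succ p.1
      push_cast
      linear_combination c p.2 * this
    rw [h3, hm, ih] at h
    push_cast at h
    have h4 : ((m : ℝ) + 1) ≠ 0 := by positivity
    refine mul_left_cancel₀ h4 ?_
    linarith

open Finset in
/-- A sequence starting at `1` is determined by its self-convolution. -/
theorem eq_of_sum_antidiagonal_eq {a b : ℕ → ℝ} (ha : a 0 = 1) (hb : b 0 = 1)
    (h : ∀ m, ∑ p ∈ antidiagonal m, a p.1 * a p.2 = ∑ p ∈ antidiagonal m, b p.1 * b p.2) :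
    a = b := by
  -- The generating functions agree up to sign, and the constant term fixes the sign.
  have hsq : PowerSeries.mk a ^ 2 = PowerSeries.mk b ^ 2 := by
    ext m
    simpa [sq, PowerSeries.coeff_mul] using h m
  rcases sq_eq_sq_iff_eq_or_eq_neg.1 hsq with h | h
  · funext m
    simpa using congrArg (PowerSeries.coeff m) h
  · have := congrArg (PowerSeries.coeff 0) h
    simp [ha, hb] at this
    norm_num at this

/-! ### Symmetric walks on the line -/

section Line

variable {Ω : Type*} [MeasurableSpace Ω] {P : Measure Ω} {Y : ℕ → Ω → ℝ}

/-- Given all summands but one, the sum vanishes only if the last one takes a prescribed value. -/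
theorem IsRandomWalk.ae_sum_ne_zero [IsProbabilityMeasure P] (hY : IsRandomWalk Y P)
    (h0 : ∀ c, P {ω | Y 0 ω = c} = 0)
    {I : Finset ℕ} (hI : I.Nonempty) : ∀ᵐ ω ∂P, ∑ i ∈ I, Y i ω ≠ 0 := by
  obtain ⟨j, hj⟩ := hI
  have hA : MeasurableSet {q : (ℕ → ℝ) × (ℕ → ℝ) | ∑ i ∈ I.erase j, q.1 i + q.2 j = 0} := by
    refine measurableSet_eq_fun ?_ measurable_const
    fun_prop
  have key := measure_and_eq_mul_of_indepFun (c := 0) (hY.measurable_maskedIncrements (I.erase j))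
    (hY.measurable_maskedIncrements {j})
    (hY.indepFun_maskedIncrements (by simp)) MeasurableSet.univ hA
    (by
      refine Filter.Eventually.of_forall fun ω _ => ?_
      have := (hY.identDistrib j).measure_mem_eq
        (measurableSet_singleton (-∑ i ∈ I.erase j, maskedIncrements Y (I.erase j) ω i))
      rw [show Y 0 ⁻¹' _ = {ω | Y 0 ω = _} from rfl, h0] at this
      convert this using 2
      ext ω'
      simp [maskedIncrements, eq_neg_iff_add_eq_zero, add_comm])
  rw [mul_zero] at key
  refine measure_mono_null ?_ key
  intro ω hω
  have hω : ∑ i ∈ I, Y i ω = 0 := by simpa using hω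
  refine ⟨trivial, ?_⟩
  change ∑ i ∈ I.erase j, maskedIncrements Y (I.erase j) ω i + maskedIncrements Y {j} ω j = 0
  rw [sum_maskedIncrements subset_rfl, maskedIncrements, if_pos (by simp),
    Finset.sum_erase_add _ _ hj, hω]

/-- The sequences of increments whose first `m` partial sums are positive. -/
def positivePaths (m : ℕ) : Set (ℕ → ℝ) :=
  {y | ∀ j ∈ Finset.Icc 1 m, 0 < ∑ i ∈ Finset.range j, y i}

theorem measurableSet_positivePaths (m : ℕ) : MeasurableSet (positivePaths m) := by
  simp only [positivePaths, Set.ofPred_forall]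
  refine MeasurableSet.iInter fun j => MeasurableSet.iInter fun _ => ?_
  exact measurableSet_lt measurable_const (by fun_prop)

theorem mem_positivePaths_congr {m : ℕ} {y z : ℕ → ℝ} (h : ∀ i < m, y i = z i) :
    y ∈ positivePaths m ↔ z ∈ positivePaths m := by
  refine forall₂_congr fun j hj => ?_
  rw [Finset.sum_congr rfl fun i hi => h i ((Finset.mem_range.1 hi).trans_le
    (Finset.mem_Icc.1 hj).2)]

/-- Reversal of the first `k` indices, as a permutation of `ℕ` fixing the others. -/
def reverseFirst (k i : ℕ) : ℕ := if i < k then k - 1 - i else i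

theorem reverseFirst_injective (k : ℕ) : (reverseFirst k).Injective := by
  intro i j h
  unfold reverseFirst at h
  split_ifs at h <;> omega

theorem sum_neg_reverse (y : ℕ → ℝ) {k l : ℕ} (h : l ≤ k) :
    ∑ i ∈ Finset.range l, -y (k - 1 - i) =
      ∑ i ∈ Finset.range (k - l), y i - ∑ i ∈ Finset.range k, y i := by
  induction l with
  | zero => simp
  | succ l ih =>
    rw [Finset.sum_range_succ, ih (by omega), show k - l = k - (l + 1) + 1 by omega,
      Finset.sum_range_succ, show k - 1 - l = k - (l + 1) by omega]
    ring

/-- The walk has its strict minimum over the times `0, …, m` at time `k` exactly when the reversed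
and negated initial path and the path after time `k` are positive. -/
theorem strictMin_iff (y : ℕ → ℝ) {k m : ℕ} (hk : k ≤ m) :
    (∀ j ≤ m, j ≠ k → ∑ i ∈ Finset.range k, y i < ∑ i ∈ Finset.range j, y i) ↔
      (fun i => -y (k - 1 - i)) ∈ positivePaths k ∧
        (fun i => y (k + i)) ∈ positivePaths (m - k) := by
  constructor
  · intro h
    refine ⟨fun l hl => ?_, fun l hl => ?_⟩ <;> rw [Finset.mem_Icc] at hl
    · rw [sum_neg_reverse y hl.2]
      linarith [h (k - l) (by omega) (by omega)]
    · have := h (k + l) (by omega) (by omega)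
      rw [Finset.sum_range_add] at this
      linarith
  · rintro ⟨h1, h2⟩ j hj hjk
    rcases lt_or_gt_of_ne hjk with hlt | hlt
    · have := h1 (k - j) (Finset.mem_Icc.2 (by omega))
      rw [sum_neg_reverse y (by omega), show k - (k - j) = j by omega] at this
      linarith
    · have := h2 (j - k) (Finset.mem_Icc.2 (by omega))
      rw [show j = k + (j - k) by omega, Finset.sum_range_add]
      linarith

/-- The minimum over the times `0, …, m` splits a symmetric walk into two independent positive
walks. -/
theorem IsRandomWalk.measureReal_strictMin (hY : IsRandomWalk Y P) (hS : CentrallySymmetric (Y 0) P)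
    {k m : ℕ} (hk : k ≤ m) :
    P.real {ω | ∀ j ≤ m, j ≠ k → walk Y k ω < walk Y j ω} =
      P.real {ω | (Y · ω) ∈ positivePaths k} * P.real {ω | (Y · ω) ∈ positivePaths (m - k)} := by
  have hφ : Measurable fun (y : ℕ → ℝ) (i : ℕ) => -y (k - 1 - i) := by fun_prop
  have hψ : Measurable fun (y : ℕ → ℝ) (i : ℕ) => y (k + i) := by fun_prop
  have hind := (hY.indepFun_maskedIncrements (S := Finset.range k) (T := Finset.Ico k m)
    (by rw [Finset.range_eq_Ico]; exact Finset.Ico_disjoint_Ico_consecutive 0 k m)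
    ).measure_inter_preimage_eq_mul _ _
      (hφ (measurableSet_positivePaths k)) (hψ (measurableSet_positivePaths (m - k)))
  have hU : ∀ ω, (fun i => -maskedIncrements Y (Finset.range k) ω (k - 1 - i)) ∈ positivePaths k ↔
      (fun i => -Y (reverseFirst k i) ω) ∈ positivePaths k := fun ω =>
    mem_positivePaths_congr fun i hi => by
      simp only [maskedIncrements, reverseFirst, hi, if_true, Finset.mem_range,
        show k - 1 - i < k by omega]
  have hU' : ∀ ω, (fun i => -Y (k - 1 - i) ω) ∈ positivePaths k ↔
      (fun i => -Y (reverseFirst k i) ω) ∈ positivePaths k := fun ω =>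
    mem_positivePaths_congr fun i hi => by simp only [reverseFirst, hi, if_true]
  have hV : ∀ ω, (fun i => maskedIncrements Y (Finset.Ico k m) ω (k + i)) ∈ positivePaths (m - k) ↔
      (fun i => Y (k + i) ω) ∈ positivePaths (m - k) := fun ω =>
    mem_positivePaths_congr fun i hi => if_pos (Finset.mem_Ico.2 (by omega))
  have h1 : P {ω | (fun i => -Y (reverseFirst k i) ω) ∈ positivePaths k} =
      P {ω | (Y · ω) ∈ positivePaths k} :=
    ((hY.reindex (reverseFirst_injective k)).comp measurable_neg).measure_mem_eq hY
      (((hY.identDistrib _).comp measurable_neg).trans hS.symm) (measurableSet_positivePaths k)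
  have h2 : P {ω | (fun i => Y (k + i) ω) ∈ positivePaths (m - k)} =
      P {ω | (Y · ω) ∈ positivePaths (m - k)} :=
    (hY.reindex (add_right_injective k)).measure_mem_eq hY (hY.identDistrib _)
      (measurableSet_positivePaths (m - k))
  rw [Measure.real, Measure.real, Measure.real, ← ENNReal.toReal_mul, ← h1, ← h2]
  refine congrArg ENNReal.toReal ?_
  convert hind using 2
  · ext ω
    exact (strictMin_iff (Y · ω) hk).trans
      (and_congr ((hU' ω).trans (hU ω).symm) (hV ω).symm)
  · exact congrArg P (Set.ext fun ω => (hU ω).symm)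
  · exact congrArg P (Set.ext fun ω => (hV ω).symm)

/-- **Sparre Andersen**: a symmetric random walk on the line without atoms stays positive during
its first `m` steps with probability `(2m-1)!! / (2m)!!`, whatever its law. -/
theorem IsRandomWalk.measureReal_positivePaths [IsProbabilityMeasure P] (hY : IsRandomWalk Y P)
    (h0 : ∀ c, P {ω | Y 0 ω = c} = 0) (hS : CentrallySymmetric (Y 0) P) (m : ℕ) :
    P.real {ω | (Y · ω) ∈ positivePaths m} = doubleFactorialRatio m := by
  refine congrFun (eq_of_sum_antidiagonal_eq (a := fun m => P.real {ω | (Y · ω) ∈ positivePaths m})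
    ?_ doubleFactorialRatio_zero fun m => ?_) m
  · simp [positivePaths]
  rw [sum_antidiagonal_doubleFactorialRatio, Finset.Nat.sum_antidiagonal_eq_sum_range_succ
    (fun k l => P.real {ω | (Y · ω) ∈ positivePaths k} * P.real {ω | (Y · ω) ∈ positivePaths l})]
  have hmeas : ∀ k, Measurable (walk Y k) := fun k =>
    Finset.measurable_fun_sum _ fun i _ => hY.measurable i
  have hdist : ∀ᵐ ω ∂P, ∀ j k, j < k → walk Y j ω ≠ walk Y k ω := by
    refine ae_all_iff.2 fun j => ae_all_iff.2 fun k => ?_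
    by_cases hjk : j < k
    · filter_upwards [hY.ae_sum_ne_zero h0 (Finset.nonempty_Ico.2 hjk)] with ω hω _ heq
      rw [Finset.sum_Ico_eq_sub _ hjk.le] at hω
      exact hω (sub_eq_zero.2 heq.symm)
    · exact Filter.Eventually.of_forall fun _ h => absurd h hjk
  rw [← probReal_univ (μ := P), measureReal_eq_sum_of_ae_iff (s := Finset.range (m + 1))
    (A := fun k => {ω | ∀ j ≤ m, j ≠ k → walk Y k ω < walk Y j ω})]
  · exact Finset.sum_congr rfl fun k hk =>
      (hY.measureReal_strictMin hS (Finset.mem_range_succ_iff.1 hk)).symm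
  · intro k _
    simp only [Set.ofPred_forall]
    refine MeasurableSet.iInter fun j => MeasurableSet.iInter fun _ => MeasurableSet.iInter fun _ =>
      measurableSet_lt (hmeas k) (hmeas j)
  · intro k hk l hl hkl
    refine Set.disjoint_left.2 fun ω h1 h2 => ?_
    exact lt_asymm (h1 l (Finset.mem_range_succ_iff.1 hl) hkl.symm)
      (h2 k (Finset.mem_range_succ_iff.1 hk) hkl)
  · filter_upwards [hdist] with ω hω
    refine ⟨fun _ => ?_, fun _ => trivial⟩
    obtain ⟨k, hk, hmin⟩ := Finset.exists_min_image (Finset.range (m + 1)) (fun j => walk Y j ω)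
      ⟨0, by simp⟩
    refine ⟨k, hk, fun j hj hjk => lt_of_le_of_ne (hmin j (Finset.mem_range_succ_iff.2 hj)) ?_⟩
    rcases lt_or_gt_of_ne hjk with h | h
    · exact (hω j k h).symm
    · exact hω k j h

end Line

/-! ### The oriented area form on the plane -/

/-- The Euclidean plane. -/
abbrev Plane : Type := EuclideanSpace ℝ (Fin 2)

/-- The oriented area `v₀ w₁ - v₁ w₀` of the parallelogram spanned by `v` and `w`. -/
def crossForm (v w : Plane) : ℝ := v 0 * w 1 - v 1 * w 0

theorem crossForm_self (v : Plane) : crossForm v v = 0 := by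
  simp only [crossForm]; ring

theorem crossForm_swap (v w : Plane) : crossForm w v = -crossForm v w := by
  simp only [crossForm]; ring

theorem crossForm_zero_left (v : Plane) : crossForm 0 v = 0 := by
  simp [crossForm]

theorem crossForm_zero_right (v : Plane) : crossForm v 0 = 0 := by
  simp [crossForm]

theorem crossForm_add_right (v w z : Plane) :
    crossForm v (w + z) = crossForm v w + crossForm v z := by
  simp only [crossForm, PiLp.add_apply]; ring

theorem crossForm_sum_right {ι : Type*} (v : Plane) (I : Finset ι) (x : ι → Plane) :
    crossForm v (∑ i ∈ I, x i) = ∑ i ∈ I, crossForm v (x i) := by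
  classical
  induction I using Finset.induction_on with
  | empty => simp [crossForm_zero_right]
  | insert i I hi ih => rw [Finset.sum_insert hi, Finset.sum_insert hi, crossForm_add_right, ih]

theorem measurable_crossForm {α : Type*} [MeasurableSpace α] {f g : α → Plane} (hf : Measurable f)
    (hg : Measurable g) : Measurable fun a => crossForm (f a) (g a) := by
  unfold crossForm
  fun_prop

theorem dot_self_pos {v : Plane} (hv : v ≠ 0) : 0 < v 0 * v 0 + v 1 * v 1 := by
  have h : ¬(v 0 = 0 ∧ v 1 = 0) := by
    rintro ⟨h0, h1⟩
    refine hv ?_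
    ext i
    fin_cases i <;> simpa
  by_cases h0 : v 0 = 0
  · exact add_pos_of_nonneg_of_pos (mul_self_nonneg _) (mul_self_pos.2 fun h1 => h ⟨h0, h1⟩)
  · exact add_pos_of_pos_of_nonneg (mul_self_pos.2 h0) (mul_self_nonneg _)

theorem crossForm_eq_iff_sub_mem_span {v p w : Plane} (hv : v ≠ 0) :
    crossForm v w = crossForm v p ↔ w - p ∈ Submodule.span ℝ {v} := by
  rw [Submodule.mem_span_singleton]
  have hd := (dot_self_pos hv).ne'
  constructor
  · intro h
    refine ⟨((w 0 - p 0) * v 0 + (w 1 - p 1) * v 1) / (v 0 * v 0 + v 1 * v 1), ?_⟩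
    simp only [crossForm] at h
    ext i
    fin_cases i
    · simp only [Fin.zero_eta, PiLp.smul_apply, smul_eq_mul, PiLp.sub_apply]
      rw [div_mul_eq_mul_div, div_eq_iff hd]
      linear_combination v 1 * h
    · simp only [Fin.mk_one, PiLp.smul_apply, smul_eq_mul, PiLp.sub_apply]
      rw [div_mul_eq_mul_div, div_eq_iff hd]
      linear_combination -v 0 * h
  · rintro ⟨t, ht⟩
    rw [show w = p + t • v by rw [ht]; abel, crossForm_add_right]
    simp only [crossForm, PiLp.smul_apply, smul_eq_mul]
    ring

/-- The level sets of `crossForm v` are the lines parallel to `v`. -/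
theorem NoMassOnHyperplanes.measure_cross_eq {Ω : Type*} [MeasurableSpace Ω] {P : Measure Ω}
    {Y : Ω → Plane} (hH : NoMassOnHyperplanes Y P) {v : Plane} (hv : v ≠ 0) (c : ℝ) :
    P {ω | crossForm v (Y ω) = c} = 0 := by
  by_cases hp : ∃ p, crossForm v p = c
  · obtain ⟨p, rfl⟩ := hp
    have := hH (AffineSubspace.mk' p (Submodule.span ℝ {v})) ⟨p, AffineSubspace.self_mem_mk' _ _⟩
      (by rw [AffineSubspace.direction_mk', finrank_span_singleton hv])
    simpa only [crossForm_eq_iff_sub_mem_span hv, AffineSubspace.mem_mk', vsub_eq_sub] using this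
  · convert measure_empty (μ := P)
    ext ω
    simpa using fun h => hp ⟨_, h⟩

/-! ### Origin and convex hull in the plane -/

theorem continuousLinearMap_plane_apply (f : Plane →L[ℝ] ℝ) :
    ∃ a b : ℝ, ∀ w, f w = a * w 0 + b * w 1 := by
  refine ⟨f (EuclideanSpace.single 0 1), f (EuclideanSpace.single 1 1), fun w => ?_⟩
  have hw : w = w 0 • EuclideanSpace.single 0 1 + w 1 • EuclideanSpace.single 1 1 := by
    ext i
    fin_cases i <;> simp
  calc f w = f (w 0 • EuclideanSpace.single 0 1 + w 1 • EuclideanSpace.single 1 1) :=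
        congrArg f hw
    _ = _ := by rw [map_add, map_smul, map_smul, smul_eq_mul, smul_eq_mul, mul_comm, mul_comm (w 1)]

/-- If finitely many points, no two of them on a line through the origin, lie in an open half-plane
bounded by a line through the origin, then one of them is the first in counterclockwise order. -/
theorem exists_cross_pos_of_zero_notMem_convexHull {ι : Type*} {s : Finset ι} {p : ι → Plane}
    (hs : s.Nonempty) (hp : ∀ i ∈ s, ∀ j ∈ s, i ≠ j → crossForm (p i) (p j) ≠ 0)
    (h : (0 : Plane) ∉ convexHull ℝ (p '' s)) :
    ∃ k ∈ s, ∀ j ∈ s, j ≠ k → 0 < crossForm (p k) (p j) := by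
  obtain ⟨f, u, hu0, hu⟩ := geometric_hahn_banach_point_closed (convex_convexHull ℝ (p '' s))
    ((s.finite_toSet.image p).isClosed_convexHull ℝ) h
  have hpos : ∀ j ∈ s, 0 < f (p j) := fun j hj => by
    have := hu _ (subset_convexHull ℝ _ ⟨j, hj, rfl⟩)
    rw [map_zero] at hu0
    exact hu0.trans this
  obtain ⟨a, b, hf⟩ := continuousLinearMap_plane_apply f
  -- `(f w, a * w 1 - b * w 0)` are the coordinates of `w` in a rotated frame, so the point of
  -- smallest slope in that frame comes first.
  obtain ⟨k, hk, hmin⟩ := s.exists_min_image (fun j => (a * p j 1 - b * p j 0) / f (p j)) hs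
  refine ⟨k, hk, fun j hj hjk => lt_of_le_of_ne ?_ (hp k hk j hj hjk.symm).symm⟩
  have h1 := hmin j hj
  rw [div_le_div_iff₀ (hpos k hk) (hpos j hj)] at h1
  have hab : 0 < a ^ 2 + b ^ 2 := by
    by_contra hab
    have ha : a = 0 := by nlinarith [sq_nonneg a, sq_nonneg b]
    have hb : b = 0 := by nlinarith [sq_nonneg a, sq_nonneg b]
    have := hpos k hk
    simp [hf, ha, hb] at this
  refine nonneg_of_mul_nonneg_right ?_ hab
  have : (a ^ 2 + b ^ 2) * crossForm (p k) (p j) =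
      (a * p j 1 - b * p j 0) * f (p k) - (a * p k 1 - b * p k 0) * f (p j) := by
    rw [hf, hf, crossForm]; ring
  linarith

theorem zero_notMem_convexHull_of_cross_pos {ι : Type*} {s : Set ι} {p : ι → Plane} {k : ι}
    (hk : p k ≠ 0) (h : ∀ j ∈ s, j ≠ k → 0 < crossForm (p k) (p j)) :
    (0 : Plane) ∉ convexHull ℝ (p '' s) := by
  -- The vectors with angle in `[0, π)` from `p k` form a convex set avoiding the origin.
  set H : Set Plane := {w | 0 < crossForm (p k) w ∨
    (crossForm (p k) w = 0 ∧ 0 < p k 0 * w 0 + p k 1 * w 1)} with hH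
  have hconv : Convex ℝ H := by
    refine convex_iff_forall_pos.2 ?_
    intro v hv w hw a b ha hb _
    have e1 : crossForm (p k) (a • v + b • w) = a * crossForm (p k) v + b * crossForm (p k) w := by
      simp only [crossForm, PiLp.add_apply, PiLp.smul_apply, smul_eq_mul]; ring
    have e2 : p k 0 * (a • v + b • w) 0 + p k 1 * (a • v + b • w) 1 =
        a * (p k 0 * v 0 + p k 1 * v 1) + b * (p k 0 * w 0 + p k 1 * w 1) := by
      simp only [PiLp.add_apply, PiLp.smul_apply, smul_eq_mul]; ring
    change _ ∨ _
    rw [e1, e2]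
    rcases hv with hv | ⟨hv, hv'⟩ <;> rcases hw with hw | ⟨hw, hw'⟩
    · left; positivity
    · left; rw [hw]; positivity
    · left; rw [hv]; positivity
    · right; rw [hv, hw]; exact ⟨by ring, by positivity⟩
  intro h0
  have : (0 : Plane) ∈ H := by
    refine convexHull_min ?_ hconv h0
    rintro _ ⟨j, hj, rfl⟩
    by_cases hjk : j = k
    · subst hjk
      exact Or.inr ⟨crossForm_self _, dot_self_pos hk⟩
    · exact Or.inl (h j hj hjk)
  simp [hH, crossForm_zero_right] at this

/-! ### General position -/

/-- A sequence of vectors is in general position when sums over disjoint nonempty sets of indices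
are linearly independent. -/
def GeneralPosition (x : ℕ → Plane) : Prop :=
  ∀ I J : Finset ℕ, I.Nonempty → J.Nonempty → Disjoint I J →
    crossForm (∑ i ∈ I, x i) (∑ i ∈ J, x i) ≠ 0

theorem GeneralPosition.sum_ne_zero {x : ℕ → Plane} (hx : GeneralPosition x) {I : Finset ℕ}
    (hI : I.Nonempty) : ∑ i ∈ I, x i ≠ 0 := by
  intro h
  -- A zero sum would be collinear with any further increment.
  obtain ⟨j, hj⟩ := Infinite.exists_notMem_finset I
  refine hx I {j} hI (Finset.singleton_nonempty j) (Finset.disjoint_singleton_right.2 hj) ?_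
  rw [h, crossForm_zero_left]

theorem GeneralPosition.cross_sum_ne_zero_of_ssubset {x : ℕ → Plane} (hx : GeneralPosition x)
    {I J : Finset ℕ} (hI : I.Nonempty) (hIJ : I ⊂ J) :
    crossForm (∑ i ∈ J, x i) (∑ i ∈ I, x i) ≠ 0 := by
  rw [← Finset.sum_sdiff hIJ.subset, crossForm_swap, crossForm_add_right,
    crossForm_self, add_zero, neg_ne_zero]
  exact hx _ _ hI (Finset.sdiff_nonempty.2 hIJ.not_subset) Finset.disjoint_sdiff

theorem IsRandomWalk.comp_crossForm {Ω : Type*} [MeasurableSpace Ω] {P : Measure Ω}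
    {X : ℕ → Ω → Plane} (hX : IsRandomWalk X P) (v : Plane) :
    IsRandomWalk (fun i ω => crossForm v (X i ω)) P :=
  hX.comp (measurable_crossForm measurable_const measurable_id)

section

variable {Ω : Type*} [MeasurableSpace Ω] {P : Measure Ω} [IsProbabilityMeasure P]
  {X : ℕ → Ω → Plane}

/-- Given the first of two disjoint sums, and that it is nonzero, the area it spans with the second
one is a sum of independent atomless variables. -/
theorem IsRandomWalk.ae_generalPosition (hX : IsRandomWalk X P)
    (hH : NoMassOnHyperplanes (X 0) P) : ∀ᵐ ω ∂P, GeneralPosition (X · ω) := by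
  have hcross : ∀ v ≠ 0, ∀ J : Finset ℕ, J.Nonempty →
      ∀ᵐ ω ∂P, crossForm v (∑ i ∈ J, X i ω) ≠ 0 := by
    intro v hv J hJ
    simpa only [crossForm_sum_right] using
      (hX.comp_crossForm v).ae_sum_ne_zero (hH.measure_cross_eq hv) hJ
  have hne : ∀ I : Finset ℕ, I.Nonempty → ∀ᵐ ω ∂P, ∑ i ∈ I, X i ω ≠ 0 := by
    intro I hI
    filter_upwards [hcross (EuclideanSpace.single 0 1) (by simp) I hI] with ω hω h
    exact hω (by rw [h, crossForm_zero_right])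
  refine ae_all_iff.2 fun I => ae_all_iff.2 fun J => ?_
  by_cases h : I.Nonempty ∧ J.Nonempty ∧ Disjoint I J
  swap
  · exact Filter.Eventually.of_forall fun _ h1 h2 h3 => absurd ⟨h1, h2, h3⟩ h
  obtain ⟨hI, hJ, hIJ⟩ := h
  have key := measure_and_eq_mul_of_indepFun (c := 0) (hX.measurable_maskedIncrements I)
    (hX.measurable_maskedIncrements J) (hX.indepFun_maskedIncrements hIJ) MeasurableSet.univ
    (A := {q | crossForm (∑ i ∈ I, q.1 i) (∑ i ∈ J, q.2 i) = 0})
    (measurableSet_eq_fun (measurable_crossForm (by fun_prop) (by fun_prop)) measurable_const)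
    (by
      filter_upwards [hne I hI] with ω hω _
      have := hcross _ hω J hJ
      simpa only [Set.mem_ofPred_eq, sum_maskedIncrements subset_rfl, ae_iff, not_not] using this)
  rw [mul_zero] at key
  have key' : ∀ᵐ ω ∂P, crossForm (∑ i ∈ I, X i ω) (∑ i ∈ J, X i ω) ≠ 0 := by
    simpa [sum_maskedIncrements subset_rfl, ae_iff] using key
  filter_upwards [key'] with ω hω _ _ _ using hω

end

/-! ### Bridges on one side of their chord -/

/-- The sequences of increments whose partial sums up to time `k` lie strictly to the left of the
vector from the origin to the last of them, apart from its endpoints. -/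
def leftBridges (k : ℕ) : Set (ℕ → Plane) :=
  {x | ∀ j ∈ Finset.Ico 1 k,
    0 < crossForm (∑ i ∈ Finset.range k, x i) (∑ i ∈ Finset.range j, x i)}

theorem measurableSet_leftBridges (k : ℕ) : MeasurableSet (leftBridges k) := by
  simp only [leftBridges, Set.ofPred_forall]
  refine MeasurableSet.iInter fun j => MeasurableSet.iInter fun _ => ?_
  exact measurableSet_lt measurable_const (measurable_crossForm (by fun_prop) (by fun_prop))

/-- Rotation by `r` of the first `k` indices, as a permutation of `ℕ` fixing the others. -/
def rotateFirst (k r i : ℕ) : ℕ := if i < k then (i + r) % k else i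

theorem injOn_add_mod (k r : ℕ) : Set.InjOn (fun i => (i + r) % k) (Finset.range k) := by
  intro i hi j hj h
  rw [Finset.mem_coe, Finset.mem_range] at hi hj
  exact Nat.ModEq.eq_of_lt_of_lt (Nat.ModEq.add_right_cancel' r h) hi hj

theorem rotateFirst_injective (k r : ℕ) : (rotateFirst k r).Injective := by
  intro i j h
  unfold rotateFirst at h
  split_ifs at h with hi hj hj
  · exact injOn_add_mod k r (by simpa using hi) (by simpa using hj) h
  · have := Nat.mod_lt (i + r) (by omega : 0 < k)
    omega
  · have := Nat.mod_lt (j + r) (by omega : 0 < k)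
    omega
  · exact h

theorem sum_range_add_mod {M : Type*} [AddCommMonoid M] (x : ℕ → M) (k r : ℕ) :
    ∑ i ∈ Finset.range k, x ((i + r) % k) = ∑ i ∈ Finset.range k, x i := by
  have hmaps : Set.MapsTo (fun i => (i + r) % k) (Finset.range k) (Finset.range k) := by
    intro i hi
    rw [Finset.mem_coe, Finset.mem_range] at hi ⊢
    exact Nat.mod_lt _ (by omega)
  exact Finset.sum_nbij (fun i => (i + r) % k) hmaps (injOn_add_mod k r)
    (Finset.surjOn_of_injOn_of_card_le _ hmaps (injOn_add_mod k r) le_rfl) fun _ _ => rfl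

/-- The heights of the periodic continuation of a bridge of length `k` above the line of its chord,
scaled by the length of the chord. -/
def bridgeHeight (x : ℕ → Plane) (k j : ℕ) : ℝ :=
  ∑ i ∈ Finset.range j, crossForm (∑ i ∈ Finset.range k, x i) (x (i % k))

theorem bridgeHeight_add (x : ℕ → Plane) (k r j : ℕ) :
    bridgeHeight x k (r + j) = bridgeHeight x k r +
      crossForm (∑ i ∈ Finset.range k, x i) (∑ i ∈ Finset.range j, x ((i + r) % k)) := by
  rw [bridgeHeight, Finset.sum_range_add, crossForm_sum_right, bridgeHeight]
  simp only [add_comm r]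

theorem bridgeHeight_periodic (x : ℕ → Plane) (k : ℕ) :
    Function.Periodic (bridgeHeight x k) k := by
  intro r
  rw [bridgeHeight_add, sum_range_add_mod, crossForm_self, add_zero]

theorem rotateFirst_mem_leftBridges_iff (x : ℕ → Plane) (k r : ℕ) :
    (fun i => x (rotateFirst k r i)) ∈ leftBridges k ↔
      ∀ j ∈ Finset.Ico 1 k, bridgeHeight x k r < bridgeHeight x k (r + j) := by
  have hsum : ∀ j ≤ k, ∑ i ∈ Finset.range j, x (rotateFirst k r i) =
      ∑ i ∈ Finset.range j, x ((i + r) % k) := fun j hj =>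
    Finset.sum_congr rfl fun i hi => by
      rw [rotateFirst, if_pos ((Finset.mem_range.1 hi).trans_le hj)]
  refine forall₂_congr fun j hj => ?_
  rw [hsum k le_rfl, hsum j (Finset.mem_Ico.1 hj).2.le, sum_range_add_mod, bridgeHeight_add,
    lt_add_iff_pos_right]

/-- The heights of a bridge at different times differ by the area spanned by its chord and a proper
part of the increments. -/
theorem GeneralPosition.bridgeHeight_ne {x : ℕ → Plane} (hx : GeneralPosition x) {k i j : ℕ}
    (hij : i < j) (hj : j < k) : bridgeHeight x k i ≠ bridgeHeight x k j := by
  obtain ⟨l, rfl⟩ := Nat.exists_eq_add_of_lt hij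
  have hsum : ∑ a ∈ Finset.range (l + 1), x ((a + i) % k) =
      ∑ a ∈ Finset.Ico i (i + l + 1), x a := by
    rw [Finset.sum_Ico_eq_sum_range, show i + l + 1 - i = l + 1 by omega]
    refine Finset.sum_congr rfl fun a ha => ?_
    rw [Finset.mem_range] at ha
    rw [Nat.mod_eq_of_lt (by omega), add_comm]
  rw [add_assoc, bridgeHeight_add, hsum, ne_comm, Ne, add_eq_left]
  refine hx.cross_sum_ne_zero_of_ssubset (Finset.nonempty_Ico.2 hij)
    (Finset.ssubset_iff_of_subset ?_ |>.2 ⟨k - 1, ?_, ?_⟩)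
  · intro a ha
    rw [Finset.mem_Ico] at ha
    exact Finset.mem_range.2 (by omega)
  · exact Finset.mem_range.2 (by omega)
  · rw [Finset.mem_Ico]
    omega

/-- The rotation starting at the lowest point of the bridge keeps it above its chord. -/
theorem GeneralPosition.exists_rotateFirst_mem {x : ℕ → Plane} (hx : GeneralPosition x) {k : ℕ}
    (hk : 1 ≤ k) : ∃ r ∈ Finset.range k, (fun i => x (rotateFirst k r i)) ∈ leftBridges k := by
  obtain ⟨r, hr, hmin⟩ := (Finset.range k).exists_min_image (bridgeHeight x k)
    ⟨0, Finset.mem_range.2 hk⟩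
  refine ⟨r, hr, (rotateFirst_mem_leftBridges_iff x k r).2 fun j hj => ?_⟩
  rw [Finset.mem_Ico] at hj
  rw [Finset.mem_range] at hr
  rw [← (bridgeHeight_periodic x k).map_mod_nat (r + j)]
  have hlt : (r + j) % k < k := Nat.mod_lt _ hk
  refine lt_of_le_of_ne (hmin _ (Finset.mem_range.2 hlt)) ?_
  have hne : r ≠ (r + j) % k := by
    rcases lt_or_ge (r + j) k with h | h
    · rw [Nat.mod_eq_of_lt h]; omega
    · rw [Nat.mod_eq_sub_mod h, Nat.mod_eq_of_lt (by omega)]; omega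
  rcases lt_or_gt_of_ne hne with h | h
  · exact hx.bridgeHeight_ne h hlt
  · exact (hx.bridgeHeight_ne h hr).symm

/-- Two different rotations cannot both be above the chord: each starting point would be strictly
lower than the other. -/
theorem not_rotateFirst_mem_of_lt (x : ℕ → Plane) {k r s : ℕ} (hrs : r < s) (hs : s < k)
    (hr : (fun i => x (rotateFirst k r i)) ∈ leftBridges k) :
    (fun i => x (rotateFirst k s i)) ∉ leftBridges k := by
  rw [rotateFirst_mem_leftBridges_iff] at hr ⊢
  intro h
  -- The walk leads from `r` to `s` in `s - r` steps, and from `s` to `r + k` in the other ones.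
  have h1 := hr (s - r) (Finset.mem_Ico.2 (by omega))
  have h2 := h (k - (s - r)) (Finset.mem_Ico.2 (by omega))
  rw [show r + (s - r) = s by omega] at h1
  rw [show s + (k - (s - r)) = r + k by omega, bridgeHeight_periodic] at h2
  exact lt_asymm h1 h2

section

variable {Ω : Type*} [MeasurableSpace Ω] {P : Measure Ω} [IsProbabilityMeasure P]
  {X : ℕ → Ω → Plane}

/-- By exchangeability, the `k` rotations of the first `k` increments are equally likely to be the
one that lies to the left of its chord. -/
theorem IsRandomWalk.measureReal_leftBridges (hX : IsRandomWalk X P)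
    (hH : NoMassOnHyperplanes (X 0) P) {k : ℕ} (hk : 1 ≤ k) :
    P.real {ω | (X · ω) ∈ leftBridges k} = 1 / k := by
  have hrot : ∀ r, P.real {ω | (fun i => X (rotateFirst k r i) ω) ∈ leftBridges k} =
      P.real {ω | (X · ω) ∈ leftBridges k} := fun r =>
    congrArg ENNReal.toReal ((hX.reindex (rotateFirst_injective k r)).measure_mem_eq hX
      (hX.identDistrib _) (measurableSet_leftBridges k))
  have h1 := measureReal_eq_sum_of_ae_iff (P := P) (E := Set.univ) (s := Finset.range k)
    (A := fun r => {ω | (fun i => X (rotateFirst k r i) ω) ∈ leftBridges k})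
    (fun r _ => (measurable_pi_lambda _ fun i => hX.measurable (rotateFirst k r i))
      (measurableSet_leftBridges k))
    (by
      intro r hr s hs hrs
      rw [Finset.mem_coe, Finset.mem_range] at hr hs
      refine Set.disjoint_left.2 fun ω h1 h2 => ?_
      rcases lt_or_gt_of_ne hrs with h | h
      · exact not_rotateFirst_mem_of_lt (X · ω) h hs h1 h2
      · exact not_rotateFirst_mem_of_lt (X · ω) h hr h2 h1)
    (by
      filter_upwards [hX.ae_generalPosition hH] with ω hω
      exact ⟨fun _ => hω.exists_rotateFirst_mem hk, fun _ => trivial⟩)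
  simp only [hrot, probReal_univ, Finset.sum_const, Finset.card_range, nsmul_eq_mul] at h1
  have hk0 : (k : ℝ) ≠ 0 := by positivity
  field_simp
  linarith

/-! ### The extreme position of the walk -/

/-- All other positions are to the left of the `k`-th one exactly when the first `k` steps form a
bridge to the left of its chord and the later steps stay to the left of the line of that chord. -/
theorem walk_cross_pos_iff (x : ℕ → Plane) {k n : ℕ} (hk : k ∈ Finset.Icc 1 n) :
    (∀ j ∈ Finset.Icc 1 n, j ≠ k →
      0 < crossForm (∑ i ∈ Finset.range k, x i) (∑ i ∈ Finset.range j, x i)) ↔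
      x ∈ leftBridges k ∧
        (fun i => crossForm (∑ i ∈ Finset.range k, x i) (x (k + i))) ∈ positivePaths (n - k) := by
  rw [Finset.mem_Icc] at hk
  have hadd : ∀ l, crossForm (∑ i ∈ Finset.range k, x i) (∑ i ∈ Finset.range (k + l), x i) =
      ∑ i ∈ Finset.range l, crossForm (∑ i ∈ Finset.range k, x i) (x (k + i)) := fun l => by
    rw [Finset.sum_range_add, crossForm_add_right, crossForm_self, zero_add, crossForm_sum_right]
  constructor
  · intro h
    refine ⟨fun j hj => ?_, fun l hl => ?_⟩
    · rw [Finset.mem_Ico] at hj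
      exact h j (Finset.mem_Icc.2 (by omega)) (by omega)
    · rw [Finset.mem_Icc] at hl
      rw [← hadd]
      exact h (k + l) (Finset.mem_Icc.2 (by omega)) (by omega)
  · rintro ⟨h1, h2⟩ j hj hjk
    rw [Finset.mem_Icc] at hj
    rcases lt_or_gt_of_ne hjk with h | h
    · exact h1 j (Finset.mem_Ico.2 (by omega))
    · rw [show j = k + (j - k) by omega, hadd]
      exact h2 (j - k) (Finset.mem_Icc.2 (by omega))

/-- The `k`-th position is the clockwise extreme one with probability
`doubleFactorialRatio (n - k) / k`: the first `k` steps form a bridge to the left of its chord, and,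
conditionally on them, the signed distances of the later positions from the line of that chord are,
up to scale, a symmetric walk that has to stay positive. -/
theorem IsRandomWalk.measureReal_walk_cross_pos (hX : IsRandomWalk X P)
    (hH : NoMassOnHyperplanes (X 0) P) (hS : CentrallySymmetric (X 0) P) {k n : ℕ}
    (hk : k ∈ Finset.Icc 1 n) :
    P.real {ω | ∀ j ∈ Finset.Icc 1 n, j ≠ k → 0 < crossForm (walk X k ω) (walk X j ω)} =
      1 / k * doubleFactorialRatio (n - k) := by
  have hk' := Finset.mem_Icc.1 hk
  have hline : ∀ v ≠ 0, P {ω | (fun i => crossForm v (X (k + i) ω)) ∈ positivePaths (n - k)} =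
      ENNReal.ofReal (doubleFactorialRatio (n - k)) := by
    intro v hv
    have hY := hX.comp_crossForm v
    have h1 := hY.measureReal_positivePaths (hH.measure_cross_eq hv)
      (by
        have hneg : (fun ω => -crossForm v (X 0 ω)) = fun ω => crossForm v (-X 0 ω) := by
          funext ω
          simp only [crossForm, PiLp.neg_apply]
          ring
        rw [CentrallySymmetric, hneg]
        exact hS.comp (u := crossForm v) (measurable_crossForm measurable_const measurable_id))
      (n - k)
    rw [← h1, ofReal_measureReal]
    exact (hY.reindex (add_right_injective k)).measure_mem_eq hY (hY.identDistrib _)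
      (measurableSet_positivePaths (n - k))
  have hsum : ∀ ω, ∀ j ≤ k, ∑ i ∈ Finset.range j, maskedIncrements X (Finset.range k) ω i =
      ∑ i ∈ Finset.range j, X i ω := fun ω j hj =>
    sum_maskedIncrements (Finset.range_subset_range.2 hj) ω
  have hB : ∀ ω, maskedIncrements X (Finset.range k) ω ∈ leftBridges k ↔
      (X · ω) ∈ leftBridges k := fun ω => by
    refine forall₂_congr fun j hj => ?_
    rw [hsum ω k le_rfl, hsum ω j (Finset.mem_Ico.1 hj).2.le]
  have hV : ∀ (v : Plane) ω,
      (fun i => crossForm v (maskedIncrements X (Finset.Ico k n) ω (k + i))) ∈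
        positivePaths (n - k) ↔
      (fun i => crossForm v (X (k + i) ω)) ∈ positivePaths (n - k) := fun v ω =>
    mem_positivePaths_congr fun i hi => by
      rw [maskedIncrements, if_pos (Finset.mem_Ico.2 (by omega))]
  have hA : Measurable fun (q : (ℕ → Plane) × (ℕ → Plane)) (i : ℕ) =>
      crossForm (∑ i ∈ Finset.range k, q.1 i) (q.2 (k + i)) :=
    measurable_pi_lambda _ fun i => measurable_crossForm (by fun_prop) (by fun_prop)
  have key := measure_and_eq_mul_of_indepFun (P := P)
    (c := ENNReal.ofReal (doubleFactorialRatio (n - k)))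
    (hX.measurable_maskedIncrements (Finset.range k))
    (hX.measurable_maskedIncrements (Finset.Ico k n))
    (hX.indepFun_maskedIncrements
      (by rw [Finset.range_eq_Ico]; exact Finset.Ico_disjoint_Ico_consecutive 0 k n))
    (measurableSet_leftBridges k) (hA (measurableSet_positivePaths (n - k)))
    (by
      filter_upwards [hX.ae_generalPosition hH] with ω hω _
      rw [← hline _ (hω.sum_ne_zero (Finset.nonempty_range_iff.2 (by omega : k ≠ 0)))]
      congr 1
      ext ω'
      refine Iff.trans ?_ (hV _ ω')
      rw [← hsum ω k le_rfl]
      rfl)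
  rw [← hX.measureReal_leftBridges hH hk'.1]
  have hnn : 0 ≤ doubleFactorialRatio (n - k) := by unfold doubleFactorialRatio; positivity
  rw [← ENNReal.toReal_ofReal hnn, Measure.real, Measure.real, ← ENNReal.toReal_mul]
  refine congrArg ENNReal.toReal ?_
  convert key using 2
  · ext ω
    refine (walk_cross_pos_iff (X · ω) hk).trans (and_congr (hB ω).symm ?_)
    refine (hV _ ω).symm.trans ?_
    rw [← hsum ω k le_rfl]
    rfl
  · exact congrArg P (Set.ext fun ω => (hB ω).symm)

end

/-! ### The probability of missing the origin -/

/-- In the term `k = n` the truncated subtraction gives `0‼ = 1`, which is the value of `(-1)‼`. -/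
theorem theorem1 {Ω : Type*} [MeasurableSpace Ω] (P : Measure Ω) [IsProbabilityMeasure P]
    (X : ℕ → Ω → EuclideanSpace ℝ (Fin 2))
    (hX : IsRandomWalk X P)
    (hH : NoMassOnHyperplanes (X 0) P)
    (hS : CentrallySymmetric (X 0) P)
    (n : ℕ) (hn : 1 ≤ n) :
    P.real {ω | (0 : EuclideanSpace ℝ (Fin 2)) ∉
        convexHull ℝ ((fun k => walk X k ω) '' Set.Icc 1 n)} =
      ∑ k ∈ Finset.Icc 1 n,
        (Nat.doubleFactorial (2 * n - 2 * k - 1) : ℝ) /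
          ((k : ℝ) * (Nat.doubleFactorial (2 * n - 2 * k) : ℝ)) := by
  have hpos : ∀ᵐ ω ∂P, ∀ i ∈ Finset.Icc 1 n, ∀ j ∈ Finset.Icc 1 n, i ≠ j →
      crossForm (walk X i ω) (walk X j ω) ≠ 0 := by
    filter_upwards [hX.ae_generalPosition hH] with ω hω
    have hlt : ∀ i j, 1 ≤ i → i < j → crossForm (walk X j ω) (walk X i ω) ≠ 0 := fun i j hi hij =>
      hω.cross_sum_ne_zero_of_ssubset (Finset.nonempty_range_iff.2 (by omega))
        (Finset.ssubset_iff_of_subset (Finset.range_subset_range.2 hij.le) |>.2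
          ⟨i, Finset.mem_range.2 hij, by simp⟩)
    intro i hi j hj hij
    rcases lt_or_gt_of_ne hij with h | h
    · rw [crossForm_swap, neg_ne_zero]
      exact hlt i j (Finset.mem_Icc.1 hi).1 h
    · exact hlt j i (Finset.mem_Icc.1 hj).1 h
  have hmeas : ∀ k, Measurable (walk X k) := fun k =>
    Finset.measurable_fun_sum _ fun i _ => hX.measurable i
  rw [measureReal_eq_sum_of_ae_iff (s := Finset.Icc 1 n) (A := fun k =>
    {ω | ∀ j ∈ Finset.Icc 1 n, j ≠ k → 0 < crossForm (walk X k ω) (walk X j ω)})]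
  · refine Finset.sum_congr rfl fun k hk => ?_
    rw [hX.measureReal_walk_cross_pos hH hS hk, doubleFactorialRatio, Nat.mul_sub,
      div_mul_div_comm, one_mul]
  · intro k _
    simp only [Set.ofPred_forall]
    exact MeasurableSet.iInter fun j => MeasurableSet.iInter fun _ => MeasurableSet.iInter fun _ =>
      measurableSet_lt measurable_const (measurable_crossForm (hmeas k) (hmeas j))
  · intro k hk l hl hkl
    refine Set.disjoint_left.2 fun ω h1 h2 => ?_
    have h3 := h1 l hl hkl.symm
    have h4 := h2 k hk hkl
    rw [crossForm_swap] at h4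
    linarith
  · filter_upwards [hpos, hX.ae_generalPosition hH] with ω hω hgp
    change (0 : Plane) ∉ convexHull ℝ ((fun k => walk X k ω) '' Set.Icc 1 n) ↔ _
    rw [← Finset.coe_Icc]
    constructor
    · exact exists_cross_pos_of_zero_notMem_convexHull (p := fun k => walk X k ω)
        (Finset.nonempty_Icc.2 hn) hω
    · rintro ⟨k, hk, h⟩
      exact zero_notMem_convexHull_of_cross_pos (p := fun k => walk X k ω)
        (hgp.sum_ne_zero (Finset.nonempty_range_iff.2 (by have := Finset.mem_Icc.1 hk; omega))) h
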